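/- **Theorem 1.4.** For $k,n\ge 0$ let $C(k,n)$ be the number of two-color (blue and red) partitions of $n$ in which the smallest part is odd and occurs at least once in blue, every even blue part is at least $2k-1$ greater than the smallest part, and even parts of the same color are distinct. For $n\in\mathbb{N}_0\cup\{\infty\}$ write $(a;q)_n:=\prod_{j=0}^{n-1}(1-aq^j)$, and define the formal power series $$C(q):=\sum_{n\ge 0}\frac{(-q^{2n+2};q^2)_\infty\, q^{2n+1}}{(q^{2n+1};q^2)_\infty^2}=:\sum_{n\ge 0}c(n)q^n,$$ $$A(q):=\frac{(-q^2;q^2)_\infty}{(q;q^2)_\infty^2},\qquad S(q):=\sum_{n\ge 0}\frac{(q;q^2)_n^2\,q^{2n}}{(-q^2;q^2)_n}.$$ Then $C(q)=\lim_{k\to\infty}\sum_{n\ge 0}C(k,n)q^n$ (coefficientwise), $C(q)=q\,A(q)\,S(q)$, and for all $n\ge 0$ $$c(8n+4)\equiv 0 \pmod 4.$$ -/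

import Mathlib

open Filter Topology
open scoped PowerSeries PowerSeries.WithPiTopology

/-- A two-color partition of `n`: a partition of `i` (the blue parts) together with a
partition of `j` (the red parts), where `i + j = n`. -/
abbrev TwoColorPartition (n : ℕ) : Type :=
  Σ ij : Finset.HasAntidiagonal.antidiagonal n, Nat.Partition ij.1.1 × Nat.Partition ij.1.2

/-- The multiset of blue parts. -/
def TwoColorPartition.blue {n : ℕ} (p : TwoColorPartition n) : Multiset ℕ := p.2.1.parts

/-- The multiset of red parts. -/
def TwoColorPartition.red {n : ℕ} (p : TwoColorPartition n) : Multiset ℕ := p.2.2.parts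

/-- The restrictions, with parameter `k`: the smallest part `m` is odd and occurs at least once
in blue, every even blue part is at least `2k - 1` greater than `m`, and even parts of the same
color are distinct. -/
def TwoColorPartition.IsRestricted {n : ℕ} (k : ℕ) (p : TwoColorPartition n) : Prop :=
  (∃ m ∈ p.blue, Odd m ∧ (∀ x ∈ p.blue + p.red, m ≤ x) ∧
    ∀ x ∈ p.blue, Even x → m + 2 * k ≤ x + 1) ∧
  ∀ x, Even x → p.blue.count x ≤ 1 ∧ p.red.count x ≤ 1

/-- `C(k, n)`, the number of restricted two-color partitions of `n` with parameter `k`. -/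
noncomputable def restrictedCount (k n : ℕ) : ℕ :=
  Nat.card {p : TwoColorPartition n // p.IsRestricted k}

/-- The generating function `C_k(q) = ∑ C(k, n) q ^ n`. -/
noncomputable def restrictedGenFun (k : ℕ) : ℤ⟦X⟧ :=
  PowerSeries.mk fun n => (restrictedCount k n : ℤ)

/-- The finite `q`-Pochhammer symbol `(a; q)_n`. -/
noncomputable def qPoch (a q : ℤ⟦X⟧) (n : ℕ) : ℤ⟦X⟧ :=
  ∏ j ∈ Finset.range n, (1 - a * q ^ j)

/-- The infinite `q`-Pochhammer symbol `(a; q)_∞`, as a product that converges coefficientwise. -/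
noncomputable def qPochInf (a q : ℤ⟦X⟧) : ℤ⟦X⟧ :=
  ∏' j : ℕ, (1 - a * q ^ j)

/-- The quotient `f / g` of formal power series, for `g` with constant coefficient `1`. -/
noncomputable def psDiv (f g : ℤ⟦X⟧) : ℤ⟦X⟧ := f * PowerSeries.invOfUnit g 1

/-- The `n`-th summand `(-q^(2n+2); q^2)_∞ q^(2n+1) / (q^(2n+1); q^2)_∞ ^ 2` of `C(q)`. -/
noncomputable def seriesCTerm (n : ℕ) : ℤ⟦X⟧ :=
  psDiv (qPochInf (-PowerSeries.X ^ (2 * n + 2)) (PowerSeries.X ^ 2) * PowerSeries.X ^ (2 * n + 1))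
    (qPochInf (PowerSeries.X ^ (2 * n + 1)) (PowerSeries.X ^ 2) ^ 2)

/-- `C(q) = ∑ (-q^(2n+2); q^2)_∞ q^(2n+1) / (q^(2n+1); q^2)_∞ ^ 2`. -/
noncomputable def seriesC : ℤ⟦X⟧ := ∑' n : ℕ, seriesCTerm n

/-- `c(n)`, the coefficient of `q ^ n` in `C(q)`. -/
noncomputable def coeffC (n : ℕ) : ℤ := PowerSeries.coeff n seriesC

/-- `A(q) = (-q^2; q^2)_∞ / (q; q^2)_∞ ^ 2`. -/
noncomputable def seriesA : ℤ⟦X⟧ :=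
  psDiv (qPochInf (-PowerSeries.X ^ 2) (PowerSeries.X ^ 2))
    (qPochInf PowerSeries.X (PowerSeries.X ^ 2) ^ 2)

/-- The `n`-th summand `(q; q^2)_n ^ 2 q^(2n) / (-q^2; q^2)_n` of `S(q)`. -/
noncomputable def seriesSTerm (n : ℕ) : ℤ⟦X⟧ :=
  psDiv (qPoch PowerSeries.X (PowerSeries.X ^ 2) n ^ 2 * PowerSeries.X ^ (2 * n))
    (qPoch (-PowerSeries.X ^ 2) (PowerSeries.X ^ 2) n)

/-- `S(q) = ∑ (q; q^2)_n ^ 2 q^(2n) / (-q^2; q^2)_n`. -/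
noncomputable def seriesS : ℤ⟦X⟧ := ∑' n : ℕ, seriesSTerm n

/-- The infinite products with base `q ^ 2` converge. -/
theorem multipliable_qPoch (a : ℤ⟦X⟧) :
    Multipliable fun j : ℕ => 1 - a * ((PowerSeries.X : ℤ⟦X⟧) ^ 2) ^ j := by
  simp_rw [sub_eq_add_neg]
  apply PowerSeries.WithPiTopology.multipliable_one_add_of_tendsto_order_atTop_nhds_top
  refine ENat.tendsto_nhds_top_iff_natCast_lt.mpr fun n => ?_
  filter_upwards [eventually_gt_atTop n] with j hj
  rw [PowerSeries.order_neg, ← pow_mul]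
  refine lt_of_lt_of_le ?_ (PowerSeries.nat_le_order _ (n+1) ?_)
  · exact_mod_cast Nat.lt_succ_self n
  · intro i hi
    rw [PowerSeries.coeff_mul_X_pow', if_neg (by omega)]

theorem summable_of_X_pow (f : ℕ → ℤ⟦X⟧) (e : ℕ → ℕ) (he : ∀ n, n ≤ e n)
    (h : ∀ n, PowerSeries.X ^ e n ∣ f n) : Summable f := by
  apply PowerSeries.WithPiTopology.summable_of_tendsto_order_atTop_nhds_top
  refine ENat.tendsto_nhds_top_iff_natCast_lt.mpr fun n => ?_
  filter_upwards [eventually_gt_atTop n] with j hj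
  refine lt_of_lt_of_le (Nat.cast_lt.mpr hj) (PowerSeries.nat_le_order _ _ ?_)
  exact PowerSeries.X_pow_dvd_iff.mp ((pow_dvd_pow _ (he j)).trans (h j))
/-- The series defining `C(q)` converges. -/
theorem summable_C : Summable seriesCTerm :=
  summable_of_X_pow _ (fun n => 2*n+1) (fun n => by omega) fun n => by
    exact Dvd.dvd.mul_right (Dvd.intro_left _ rfl) _
/-- The series defining `S(q)` converges. -/
theorem summable_S : Summable seriesSTerm :=
  summable_of_X_pow _ (fun n => 2*n) (fun n => by omega) fun n => by
    exact Dvd.dvd.mul_right (Dvd.intro_left _ rfl) _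

/-- The infinite products used as denominators have constant coefficient `1`. -/
theorem qPochInf_const (a : ℤ⟦X⟧) (ha : PowerSeries.constantCoeff a = 0) :
    PowerSeries.constantCoeff (qPochInf a (PowerSeries.X ^ 2)) = 1 := by
  rw [qPochInf, Multipliable.map_tprod (multipliable_qPoch _) _
    (PowerSeries.WithPiTopology.continuous_constantCoeff ℤ)]
  simp [ha]

/-- `psDiv` is division. -/
theorem psDiv_mul (f g : ℤ⟦X⟧) (h : PowerSeries.constantCoeff g = 1) : psDiv f g * g = f := by
  rw [psDiv, mul_assoc, mul_comm _ g, PowerSeries.mul_invOfUnit _ _ (by simpa using h), mul_one]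

/-! Combinatorial limit. If k > n, an even blue part would exceed n, so the blue parts are odd.
Sorting by the smallest part 2s+1 gives, for each s, the product of a blue and a red generating
function, which is the s-th summand of C(q) (`seriesCTerm_eq_genFun`). Hence C(k,n) = c(n) exactly
for k > n. The factorisation C = qAS holds summand by summand, by splitting n factors off the
infinite products.

Congruence. After removing the factor q, the coefficient of q^(8n+3) is needed modulo 4. Replacing
(-q^(2j+2);q^2)_∞ by (q^(2j+2);q^2)_∞ changes odd coefficients by multiples of 4 only, since each
summand is a series in q^2 times a square (`four_dvd_coeff_sub`). Bailey's lemma (`sum_bailey_eq`)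
turns the new sum into 1/E times ∑ (-1)^r q^(3r(r+1)) (1+y)/(1-y), where E = (q^2;q^2)_∞ and y =
q^(2r+1). Since (1+y)/(1-y) = 1 + 2∑ y^k, its odd part is 2/E times the limit of `appellOdd`.

It remains to see that the coefficient of q^(8n+3) in that limit divided by E is even. Modulo 2, 1/E
= E^3/E^4, where E^4 is a series in q^8 and E^3 is Gauss's series ∑ q^(m(m+1)). So it suffices that
m(m+1) + 3r(r+1) + (2r+1)(2k+1) = 8n+3 has an even number of solutions. They correspond to odd
solutions of t^2 + ad = 8n+4 with 0 < d < t + a, on which an involution in the style of Zagier's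
windmills has no fixed point (`even_card_windmill`). -/

/-! ### Finite Bailey-type identities, with u n playing the role of 1/(q^2;q^2)_n -/

section QIdentities

variable {R : Type*} [CommRing R]

/-- A telescoping certificate: the summand of `sum_pentagonal_eq` satisfies a first-order recurrence
in n = m + k up to a difference in r, and the right side is that difference accumulated up to r = m.
Writing n as m + k keeps the subtractions exact; k is generalised so that n stays fixed during the
induction. Only k = 0 is used later. -/
theorem pentagonal_certificate (q : R) (u : ℕ → R)
    (hu : ∀ n, u n = (1 - q ^ (2 * n + 2)) * u (n + 1)) (m k : ℕ) :
    ∑ r ∈ Finset.range (m + 1),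
      ((1 - q ^ (2 * (m + k) + 2)) * ((-1) ^ r * q ^ (r * (3 * r + 1)) * (1 - q ^ (4 * r + 2)) *
        u (m + k + 1 - r) * u (m + k + r + 2)) -
      (-1) ^ r * q ^ (r * (3 * r + 1)) * (1 - q ^ (4 * r + 2)) * u (m + k - r) * u (m + k + r + 1))
      = q ^ (2 * (m + k) + 2) * q ^ (4 * m + 2) * (1 - q ^ (2 * m + 2)) * (-1) ^ m *
        q ^ (m * (3 * m + 1)) * u k * u (2 * m + k + 2) := by
  induction m generalizing k with
  | zero =>
    have h1 := hu k
    have h2 := hu (k + 1)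
    simp only [zero_add, Finset.sum_range_one, Nat.sub_zero, mul_zero, add_zero, zero_mul, pow_zero]
    rw [h1, h2]
    ring
  | succ m ih =>
    rw [Finset.sum_range_succ]
    have e1 : m + 1 + k = m + (k + 1) := by ring
    rw [e1, ih (k + 1)]
    have h1 := hu k
    have h2 := hu (2 * m + k + 3)
    rw [show m + (k + 1) + 1 - (m + 1) = k + 1 by omega,
      show m + (k + 1) - (m + 1) = k by omega,
      show m + (k + 1) + (m + 1) + 2 = 2 * m + k + 3 + 1 by omega,
      show m + (k + 1) + (m + 1) + 1 = 2 * m + k + 3 by omega,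
      show 2 * m + (k + 1) + 2 = 2 * m + k + 3 by omega,
      show 2 * (m + 1) + k + 2 = 2 * m + k + 3 + 1 by omega, h1, h2]
    ring

/-- The Bailey pair relative to `q` with `β n = 1 / (q)_n`, in base `q ^ 2`. -/
theorem sum_pentagonal_eq (q : R) (u : ℕ → R) (h0 : u 0 = 1)
    (hu : ∀ n, u n = (1 - q ^ (2 * n + 2)) * u (n + 1)) (n : ℕ) :
    ∑ r ∈ Finset.range (n + 1), (-1) ^ r * q ^ (r * (3 * r + 1)) * (1 - q ^ (4 * r + 2)) *
        u (n - r) * u (n + r + 1) = u n := by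
  have hunit : ∀ n, IsUnit (u n) := by
    intro n
    induction n with
    | zero => simp [h0]
    | succ n ih => exact isUnit_of_mul_isUnit_right (hu n ▸ ih)
  induction n with
  | zero =>
    have h1 := hu 0
    simp only [zero_add, Finset.sum_range_one, Nat.sub_zero, mul_zero, zero_mul, pow_zero] at h1 ⊢
    rw [h0] at h1 ⊢
    rw [one_mul, one_mul, mul_one, ← h1]
  | succ n ih =>
    have hc : IsUnit (1 - q ^ (2 * n + 2)) := isUnit_of_mul_isUnit_left (hu n ▸ hunit n)
    refine hc.mul_left_cancel ?_
    rw [← hu n]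
    refine Eq.trans ?_ ih
    -- The certificate at k = 0 is exactly cancelled by the extra summand r = n + 1.
    have key := pentagonal_certificate q u hu n 0
    have h2 := hu (2 * n + 2)
    rw [Finset.sum_range_succ, mul_add, Finset.mul_sum]
    rw [Finset.sum_sub_distrib, sub_eq_iff_eq_add] at key
    simp only [add_zero] at key
    rw [Finset.sum_congr rfl (fun r _ => by
      rw [show n + 1 + r + 1 = n + r + 2 by ring]), key, h2,
      show n + 1 - (n + 1) = 0 by omega, show n + 1 + (n + 1) + 1 = 2 * n + 2 + 1 by ring]
    ring

/-- Bailey's lemma in base q^2 with both parameters equal to q, applied to the pair of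
`sum_pentagonal_eq`. In this case it has an exact truncated form: expanding the new u (N + 1) by
that pair makes the induction step hold separately for each r. -/
theorem sum_bailey_eq (q : R) (u v g : ℕ → R) (h0 : u 0 = 1)
    (hu : ∀ n, u n = (1 - q ^ (2 * n + 2)) * u (n + 1))
    (hv : ∀ r, (1 - q ^ (2 * r + 1)) * v r = 1)
    (g0 : g 0 = 1) (hg : ∀ n, g (n + 1) = g n * (1 - q ^ (2 * n + 1))) (N : ℕ) :
    ∑ n ∈ Finset.range (N + 1), q ^ (2 * n) * g n ^ 2 * u n =
    g (N + 1) ^ 2 * ∑ r ∈ Finset.range (N + 1), (-1) ^ r * q ^ (3 * r * (r + 1)) *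
      ((1 + q ^ (2 * r + 1)) * v r) * u (N - r) * u (N + r + 1) := by
  induction N with
  | zero =>
    have h1 := hu 0
    have h2 := hv 0
    have h3 := hg 0
    simp only [zero_add, Finset.sum_range_one, Nat.sub_zero, mul_zero, zero_mul, pow_zero,
      pow_one] at h1 h2 h3 ⊢
    rw [h3, g0]
    rw [h0] at h1 ⊢
    linear_combination h1 - (1 - q) * (1 + q) * u 1 * h2
  | succ N ih =>
    rw [Finset.sum_range_succ, ih, ← sum_pentagonal_eq q u h0 hu (N + 1), Finset.mul_sum,
      Finset.mul_sum, Finset.mul_sum, Finset.sum_range_succ _ (N + 1),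
      Finset.sum_range_succ _ (N + 1), ← add_assoc, ← Finset.sum_add_distrib, hg (N + 1)]
    congr 1
    · refine Finset.sum_congr rfl fun r hr => ?_
      obtain ⟨k, rfl⟩ := Nat.exists_eq_add_of_le (Nat.lt_succ_iff.mp (Finset.mem_range.mp hr))
      rw [show r + k - r = k by omega, show r + k + 1 - r = k + 1 by omega,
        show r + k + 1 + r + 1 = 2 * r + k + 1 + 1 by ring,
        show r + k + r + 1 = 2 * r + k + 1 by ring, hu k, hu (2 * r + k + 1)]
      linear_combination (-(g (r + k + 1)) ^ 2 * q ^ (2 * (r + k + 1)) * (-1) ^ r *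
        q ^ (r * (3 * r + 1)) * (1 - q ^ (2 * r + 1)) * (1 + q ^ (2 * r + 1)) *
        u (k + 1) * u (2 * r + k + 1 + 1)) * hv r
    · linear_combination (-(g (N + 1)) ^ 2 * q ^ (2 * (N + 1)) * (-1) ^ (N + 1) *
        q ^ ((N + 1) * (3 * (N + 1) + 1)) * (1 - q ^ (2 * (N + 1) + 1)) *
        (1 + q ^ (2 * (N + 1) + 1)) *
        u (N + 1 - (N + 1)) * u (N + 1 + (N + 1) + 1)) * hv (N + 1)

/-- The analogue of `pentagonal_certificate` for the sum in `sum_triangular_eq`. -/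
theorem triangular_certificate (q : R) (u : ℕ → R)
    (hu : ∀ n, u n = (1 - q ^ (2 * n + 2)) * u (n + 1)) (m k : ℕ) :
    ∑ r ∈ Finset.range (m + 1),
      ((1 - q ^ (2 * (m + k) + 2)) * (1 - q ^ (4 * (m + k) + 6)) * (q ^ (r * (r + 1)) *
        u (m + k + 1 - r) * u (m + k + r + 2)) -
      (1 + q ^ (2 * (m + k) + 2)) * (q ^ (r * (r + 1)) * u (m + k - r) * u (m + k + r + 1)))
      = q ^ (2 * (m + k) + 2) * (q ^ (2 * m + 2) - 1) *
        q ^ (m * (m + 1)) * u k * u (2 * m + k + 2) := by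
  induction m generalizing k with
  | zero =>
    have h1 := hu k
    have h2 := hu (k + 1)
    simp only [zero_add, Finset.sum_range_one, Nat.sub_zero, mul_zero, add_zero, zero_mul, pow_zero]
    rw [h1, h2]
    ring
  | succ m ih =>
    rw [Finset.sum_range_succ]
    have e1 : m + 1 + k = m + (k + 1) := by ring
    rw [e1, ih (k + 1)]
    have h1 := hu k
    have h2 := hu (2 * m + k + 3)
    rw [show m + (k + 1) + 1 - (m + 1) = k + 1 by omega,
      show m + (k + 1) - (m + 1) = k by omega,
      show m + (k + 1) + (m + 1) + 2 = 2 * m + k + 3 + 1 by omega,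
      show m + (k + 1) + (m + 1) + 1 = 2 * m + k + 3 by omega,
      show 2 * m + (k + 1) + 2 = 2 * m + k + 3 by omega,
      show 2 * (m + 1) + k + 2 = 2 * m + k + 3 + 1 by omega, h1, h2]
    ring

/-- A finite form of Gauss's product for the generating function of triangular numbers. -/
theorem sum_triangular_eq (q : R) (u d : ℕ → R) (h0 : u 0 = 1)
    (hu : ∀ n, u n = (1 - q ^ (2 * n + 2)) * u (n + 1))
    (d0 : d 0 = 1) (hd : ∀ n, d (n + 1) = d n * (1 + q ^ (2 * n + 2))) (n : ℕ) :
    ∑ r ∈ Finset.range (n + 1), q ^ (r * (r + 1)) * u (n - r) * u (n + r + 1) =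
      d n ^ 2 * u (2 * n + 1) := by
  have hunit : ∀ n, IsUnit (u n) := by
    intro n
    induction n with
    | zero => simp [h0]
    | succ n ih => exact isUnit_of_mul_isUnit_right (hu n ▸ ih)
  have hc : ∀ n, IsUnit (1 - q ^ (2 * n + 2)) := fun n =>
    isUnit_of_mul_isUnit_left (hu n ▸ hunit n)
  induction n with
  | zero => simp [h0, d0]
  | succ n ih =>
    refine ((hc n).mul (hc (2 * n + 2))).mul_left_cancel ?_
    have key := triangular_certificate q u hu n 0
    have h1 := hu (2 * n + 1)
    have h2 := hu (2 * n + 2)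
    rw [Finset.sum_sub_distrib, sub_eq_iff_eq_add, ← Finset.mul_sum, ← Finset.mul_sum] at key
    simp only [add_zero] at key
    rw [ih] at key
    rw [Finset.sum_range_succ, mul_add, Finset.sum_congr rfl (fun r _ => by
      rw [show n + 1 + r + 1 = n + r + 2 by ring]),
      show 2 * (2 * n + 2) + 2 = 4 * n + 6 by ring, key, hd, h1, h2,
      show n + 1 - (n + 1) = 0 by omega, show n + 1 + (n + 1) + 1 = 2 * n + 2 + 1 by ring,
      show 2 * (n + 1) + 1 = 2 * n + 2 + 1 by ring]
    ring

end QIdentities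

/-! ### Parity of a ternary representation count by a windmill involution -/

section Parity

/-- The involution showing that the number of odd solutions of `t ^ 2 + a * d = M` with `0 < d` and
`d < t + a` is even when `M` is `4` modulo `8`. -/
def windmillSwap (x : ℤ × ℤ × ℤ) : ℤ × ℤ × ℤ :=
  if x.2.1 < 0 then (x.1, -x.2.2, -x.2.1)
  else if x.2.1 - x.2.2 < x.1 then (x.1, x.2.2, x.2.1)
  else (-x.1, x.2.1, x.2.2)

/-- The odd solutions of `t ^ 2 + a * d = M` with `0 < d` and `d < t + a`. -/
def IsWindmill (M : ℤ) (x : ℤ × ℤ × ℤ) : Prop :=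
  x.1 % 2 = 1 ∧ x.2.1 % 2 = 1 ∧ x.2.2 % 2 = 1 ∧ x.1 ^ 2 + x.2.1 * x.2.2 = M ∧ 0 < x.2.2 ∧
    x.2.2 < x.1 + x.2.1

/-- Each branch condition is the inequality needed for the image. In the last branch only d ≤ a - t
is known; it is strict because a - d is even and t is odd. -/
theorem IsWindmill.swap {M : ℤ} {x : ℤ × ℤ × ℤ} (h : IsWindmill M x) :
    IsWindmill M (windmillSwap x) := by
  obtain ⟨t, a, d⟩ := x
  obtain ⟨h1, h2, h3, h4, h5, h6⟩ := h
  simp only at h1 h2 h3 h4 h5 h6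
  unfold windmillSwap
  split_ifs with ha hb
  · refine ⟨h1, ?_, ?_, ?_, ?_, ?_⟩ <;> simp only at * <;> first | omega | linarith
  · refine ⟨h1, ?_, ?_, ?_, ?_, ?_⟩ <;> simp only at * <;> first | omega | linarith
  · refine ⟨?_, ?_, ?_, ?_, ?_, ?_⟩ <;> simp only at * <;> first | omega | linarith

theorem IsWindmill.swap_swap {M : ℤ} {x : ℤ × ℤ × ℤ} (h : IsWindmill M x) :
    windmillSwap (windmillSwap x) = x := by
  obtain ⟨t, a, d⟩ := x
  obtain ⟨h1, h2, h3, h4, h5, h6⟩ := h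
  simp only at h1 h2 h3 h4 h5 h6
  unfold windmillSwap
  simp only
  split_ifs <;> simp only [neg_neg, Prod.mk.injEq, true_and] at * <;> omega

/-- In the three branches a fixed point would give M = t^2 - a^2 ≡ 0, M = t^2 + a^2 ≡ 2 modulo 8, or
t = 0, which is not odd. -/
theorem IsWindmill.swap_ne {M : ℤ} (hM : M % 8 = 4) {x : ℤ × ℤ × ℤ} (h : IsWindmill M x) :
    windmillSwap x ≠ x := by
  obtain ⟨t, a, d⟩ := x
  obtain ⟨h1, h2, h3, h4, h5, h6⟩ := h
  simp only at h1 h2 h3 h4 h5 h6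
  have sq (z : ℤ) (hz : z % 2 = 1) : z ^ 2 % 8 = 1 := by
    have : z % 8 = 1 ∨ z % 8 = 3 ∨ z % 8 = 5 ∨ z % 8 = 7 := by omega
    rcases this with h | h | h | h <;> simp [pow_two, Int.mul_emod, h]
  unfold windmillSwap
  split_ifs with ha hb <;> intro he <;> simp only [Prod.mk.injEq, true_and] at he ha
  · have h7 := sq t h1
    have h8 := sq a h2
    rw [show d = -a by omega] at h4
    have : t ^ 2 - a ^ 2 = M := by linarith
    omega
  · have h7 := sq t h1
    have h8 := sq a h2
    rw [show d = a by omega] at h4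
    have : t ^ 2 + a ^ 2 = M := by linarith
    omega
  · omega

/-- The change of variables from `m(m+1) + 3r(r+1) + (2r+1)(2k+1) = M - 1` to windmills. -/
def toWindmill (x : ℕ × ℕ × ℕ) : ℤ × ℤ × ℤ :=
  if (x.1 + x.2.1) % 2 = 0 then (x.2.1 + x.1 + 1, x.2.1 - x.1 + 2 * x.2.2 + 1, 2 * x.2.1 + 1)
  else (x.2.1 - x.1, x.2.1 + x.1 + 2 * x.2.2 + 2, 2 * x.2.1 + 1)

/-- The inverse of `toWindmill`. -/
def ofWindmill (x : ℤ × ℤ × ℤ) : ℕ × ℕ × ℕ :=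
  (if 0 < 2 * x.1 - x.2.2 then ((2 * x.1 - x.2.2 - 1) / 2).toNat
    else ((x.2.2 - 2 * x.1 - 1) / 2).toNat,
  ((x.2.2 - 1) / 2).toNat, ((x.1 + x.2.1 - x.2.2 - 1) / 2).toNat)

/-- The coordinates are recovered from d = 2r+1, t + a - d = 2k+1 and 2t - d = ±(2m+1), with the
plus sign exactly when m + r is even. -/
theorem ofWindmill_toWindmill (x : ℕ × ℕ × ℕ) : ofWindmill (toWindmill x) = x := by
  obtain ⟨m, r, k⟩ := x
  unfold ofWindmill toWindmill
  split_ifs <;> simp only [Prod.mk.injEq] at * <;> omega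

theorem IsWindmill.toWindmill_ofWindmill {M : ℤ} {x : ℤ × ℤ × ℤ} (h : IsWindmill M x) :
    toWindmill (ofWindmill x) = x := by
  obtain ⟨t, a, d⟩ := x
  obtain ⟨h1, h2, h3, h4, h5, h6⟩ := h
  simp only at h1 h2 h3 h4 h5 h6
  unfold ofWindmill toWindmill
  simp only
  split_ifs <;> simp only [Prod.mk.injEq] at * <;> omega

/-- The two branches are exchanged by m ↦ -1 - m, which preserves m(m+1); the parity of m + r
selects the one with t odd. The condition d < t + a amounts to k ≥ 0. -/
theorem isWindmill_toWindmill {M m r k : ℕ}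
    (h : m * (m + 1) + 3 * r * (r + 1) + (2 * r + 1) * (2 * k + 1) + 1 = M) :
    IsWindmill M (toWindmill (m, r, k)) := by
  unfold toWindmill
  subst h
  split_ifs with h0 <;> refine ⟨?_, ?_, ?_, ?_, ?_, ?_⟩ <;> simp only at * <;>
    first | omega | (push_cast; ring)

theorem IsWindmill.eq_of_toWindmill {M m r k : ℕ} (h : IsWindmill M (toWindmill (m, r, k))) :
    m * (m + 1) + 3 * r * (r + 1) + (2 * r + 1) * (2 * k + 1) + 1 = M := by
  obtain ⟨h1, h2, h3, h4, h5, h6⟩ := h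
  unfold toWindmill at *
  zify
  rw [← h4]
  split_ifs with h0 <;> simp only <;> ring

theorem even_card_windmill (n N : ℕ) (hN : 8 * n + 3 ≤ N) :
    Even (((Finset.range (N + 1) ×ˢ Finset.range (N + 1) ×ˢ Finset.range (N + 1)).filter
      fun x : ℕ × ℕ × ℕ => x.1 * (x.1 + 1) + 3 * x.2.1 * (x.2.1 + 1) +
        (2 * x.2.1 + 1) * (2 * x.2.2 + 1) = 8 * n + 3).card) := by
  rw [← ZMod.natCast_eq_zero_iff_even, Finset.cast_card]
  have hw : ∀ x : ℕ × ℕ × ℕ, x.1 * (x.1 + 1) + 3 * x.2.1 * (x.2.1 + 1) +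
        (2 * x.2.1 + 1) * (2 * x.2.2 + 1) = 8 * n + 3 ↔
        IsWindmill ((8 * n + 4 : ℕ) : ℤ) (toWindmill x) := by
    rintro ⟨m, r, k⟩
    refine ⟨fun h => isWindmill_toWindmill ?_, fun h => ?_⟩
    · simp only at h
      omega
    · have := h.eq_of_toWindmill
      simp only
      omega
  have hback : ∀ x : ℕ × ℕ × ℕ, IsWindmill ((8 * n + 4 : ℕ) : ℤ) (toWindmill x) →
      toWindmill (ofWindmill (windmillSwap (toWindmill x))) = windmillSwap (toWindmill x) :=
    fun x hx => hx.swap.toWindmill_ofWindmill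
  refine Finset.sum_involution (fun x _ => ofWindmill (windmillSwap (toWindmill x)))
    (fun _ _ => by decide) ?_ ?_ ?_
  · intro x hx _ he
    have hx' := (hw x).mp (Finset.mem_filter.mp hx).2
    have := hback x hx'
    rw [he] at this
    exact hx'.swap_ne (by omega) this.symm
  · intro x hx
    have hx' := (hw x).mp (Finset.mem_filter.mp hx).2
    have hy := hback x hx'
    have hz : IsWindmill ((8 * n + 4 : ℕ) : ℤ)
      (toWindmill (ofWindmill (windmillSwap (toWindmill x)))) := by
      rw [hy]; exact hx'.swap
    have he := (hw _).mpr hz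
    simp only [Finset.mem_filter, Finset.mem_product, Finset.mem_range]
    -- The equation bounds each coordinate by 8n+3, so the box contains every solution.
    refine ⟨⟨?_, ?_, ?_⟩, he⟩ <;> nlinarith
  · intro x hx
    have hx' := (hw x).mp (Finset.mem_filter.mp hx).2
    rw [hback x hx', hx'.swap_swap, ofWindmill_toWindmill]

end Parity

/-! ### Infinite products modulo X ^ K -/

section Truncation

open PowerSeries

/-- Reduction of power series modulo `X ^ K`. -/
noncomputable abbrev modXPow (K : ℕ) : ℤ⟦X⟧ →+* ℤ⟦X⟧ ⧸ Ideal.span {(X : ℤ⟦X⟧) ^ K} :=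
  Ideal.Quotient.mk _

theorem modXPow_eq_iff {K : ℕ} {a b : ℤ⟦X⟧} : modXPow K a = modXPow K b ↔ X ^ K ∣ a - b := by
  rw [Ideal.Quotient.eq, Ideal.mem_span_singleton]

theorem modXPow_eq_zero_iff {K : ℕ} {a : ℤ⟦X⟧} : modXPow K a = 0 ↔ X ^ K ∣ a := by
  rw [Ideal.Quotient.eq_zero_iff_dvd]

theorem coeff_eq_of_modXPow_eq {K k : ℕ} (hk : k < K) {a b : ℤ⟦X⟧}
    (h : modXPow K a = modXPow K b) : coeff k a = coeff k b := by
  have := X_pow_dvd_iff.mp (modXPow_eq_iff.mp h) k hk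
  rwa [map_sub, sub_eq_zero] at this

theorem qPoch_succ (a q : ℤ⟦X⟧) (n : ℕ) : qPoch a q (n + 1) = qPoch a q n * (1 - a * q ^ n) :=
  Finset.prod_range_succ _ _

theorem qPoch_add (a q : ℤ⟦X⟧) (m n : ℕ) :
    qPoch a q (m + n) = qPoch a q m * qPoch (a * q ^ m) q n := by
  rw [qPoch, Finset.prod_range_add, qPoch, qPoch]
  simp only [pow_add, mul_assoc]

theorem constantCoeff_qPoch {a : ℤ⟦X⟧} (ha : constantCoeff a = 0) (q : ℤ⟦X⟧) (n : ℕ) :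
    constantCoeff (qPoch a q n) = 1 := by
  simp [qPoch, ha]

theorem modXPow_qPoch_eq_one {K : ℕ} {a : ℤ⟦X⟧} (ha : X ^ K ∣ a) (q : ℤ⟦X⟧) (n : ℕ) :
    modXPow K (qPoch a q n) = 1 := by
  rw [qPoch, map_prod]
  refine Finset.prod_eq_one fun j _ => ?_
  rw [map_sub, map_mul, modXPow_eq_zero_iff.mpr ha, zero_mul, sub_zero, map_one]

theorem qPochInf_eq_qPoch_mul (a : ℤ⟦X⟧) (n : ℕ) :
    qPochInf a (X ^ 2) = qPoch a (X ^ 2) n * qPochInf (a * (X ^ 2) ^ n) (X ^ 2) := by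
  have e : ∀ j : ℕ, 1 - a * ((X : ℤ⟦X⟧) ^ 2) ^ n * (X ^ 2) ^ j = 1 - a * (X ^ 2) ^ (j + n) := by
    intro j
    rw [mul_assoc, ← pow_add, add_comm]
  have h := multipliable_qPoch (a * ((X : ℤ⟦X⟧) ^ 2) ^ n)
  rw [funext e] at h
  rw [qPochInf, qPoch, qPochInf, funext e]
  exact (h.prod_mul_tprod_nat_mul' (f := fun j : ℕ => 1 - a * ((X : ℤ⟦X⟧) ^ 2) ^ j)).symm

theorem modXPow_qPochInf_eq_one {K : ℕ} {a : ℤ⟦X⟧} (ha : X ^ K ∣ a) :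
    modXPow K (qPochInf a (X ^ 2)) = 1 := by
  rw [← map_one (modXPow K), modXPow_eq_iff, X_pow_dvd_iff]
  intro k hk
  have h : Tendsto (fun n => coeff k (qPoch a (X ^ 2) n)) atTop
      (𝓝 (coeff k (qPochInf a (X ^ 2)))) :=
    ((WithPiTopology.continuous_coeff ℤ k).tendsto _).comp
      (multipliable_qPoch a).hasProd.tendsto_prod_nat
  have h2 : ∀ n, coeff k (qPoch a (X ^ 2) n) = coeff k (1 : ℤ⟦X⟧) := fun n =>
    coeff_eq_of_modXPow_eq hk (by rw [modXPow_qPoch_eq_one ha, map_one])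
  simp only [h2] at h
  rw [map_sub, tendsto_nhds_unique h tendsto_const_nhds, sub_self]

theorem modXPow_qPochInf {K n : ℕ} {a : ℤ⟦X⟧} (ha : X ^ K ∣ a * (X ^ 2) ^ n) :
    modXPow K (qPochInf a (X ^ 2)) = modXPow K (qPoch a (X ^ 2) n) := by
  rw [qPochInf_eq_qPoch_mul a n, map_mul, modXPow_qPochInf_eq_one ha, mul_one]

theorem modXPow_qPoch_add {K n : ℕ} {a : ℤ⟦X⟧} (ha : X ^ K ∣ a * (X ^ 2) ^ n) (m : ℕ) :
    modXPow K (qPoch a (X ^ 2) (n + m)) = modXPow K (qPoch a (X ^ 2) n) := by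
  rw [qPoch_add, map_mul, modXPow_qPoch_eq_one ha, mul_one]

theorem modXPow_invOfUnit {K : ℕ} {a b : ℤ⟦X⟧} (ha : constantCoeff a = 1)
    (hb : constantCoeff b = 1) (h : modXPow K a = modXPow K b) :
    modXPow K (invOfUnit a 1) = modXPow K (invOfUnit b 1) := by
  have h1 := congrArg (modXPow K) (mul_invOfUnit a 1 (by simpa using ha))
  have h2 := congrArg (modXPow K) (mul_invOfUnit b 1 (by simpa using hb))
  rw [map_mul, map_one] at h1 h2
  rw [h] at h1
  linear_combination (modXPow K (invOfUnit b 1)) * h1 - (modXPow K (invOfUnit a 1)) * h2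

end Truncation

/-! ### Series in X ^ 2 and Frobenius modulo 2 -/

section CoefficientsModTwo

open PowerSeries

theorem sq_eq_expand (f : (ZMod 2)⟦X⟧) : f ^ 2 = expand 2 two_ne_zero f := by
  have := MvPowerSeries.map_frobenius_expand (R := ZMod 2) 2 two_ne_zero (f := f)
  rw [← this, ZMod.frobenius_zmod, MvPowerSeries.map_id]
  rfl

theorem even_coeff_iff (k : ℕ) (f : ℤ⟦X⟧) :
    2 ∣ coeff k f ↔ coeff k (map (Int.castRingHom (ZMod 2)) f) = 0 := by
  rw [coeff_map, eq_intCast, ZMod.intCast_zmod_eq_zero_iff_dvd]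
  norm_cast

theorem two_dvd_coeff_sq {k : ℕ} (hk : Odd k) (f : ℤ⟦X⟧) : 2 ∣ coeff k (f ^ 2) := by
  rw [even_coeff_iff, map_pow, sq_eq_expand, coeff_expand_of_not_dvd]
  exact hk.not_two_dvd_nat

/-- The power series in `X ^ 2`. -/
def evenSeries : Subring ℤ⟦X⟧ where
  carrier := {f | ∀ k, Odd k → coeff k f = 0}
  zero_mem' _ _ := by simp
  one_mem' k hk := by
    rw [coeff_one, if_neg (by rintro rfl; simp at hk)]
  add_mem' ha hb k hk := by rw [map_add, ha k hk, hb k hk, add_zero]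
  neg_mem' ha k hk := by rw [map_neg, ha k hk, neg_zero]
  mul_mem' {a b} ha hb k hk := by
    rw [coeff_mul]
    refine Finset.sum_eq_zero fun x hx => ?_
    rw [Finset.HasAntidiagonal.mem_antidiagonal] at hx
    rcases Nat.even_or_odd x.1 with h | h
    · rw [hb x.2 (by subst hx; exact (Nat.odd_add'.mp hk).mpr h), mul_zero]
    · rw [ha x.1 h, zero_mul]

theorem X_sq_mem_evenSeries : (X : ℤ⟦X⟧) ^ 2 ∈ evenSeries := by
  intro k hk
  rw [coeff_X_pow, if_neg (by rintro rfl; revert hk; decide)]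

theorem qPoch_mem_evenSeries {a : ℤ⟦X⟧} (ha : a ∈ evenSeries) (n : ℕ) :
    qPoch a (X ^ 2) n ∈ evenSeries :=
  prod_mem fun j _ => sub_mem (one_mem _) (mul_mem ha (pow_mem X_sq_mem_evenSeries j))

/-- In an odd coefficient of f * g, every term but the one pairing the constant coefficient of f
with the top coefficient of g vanishes, by induction or by parity. -/
theorem inverse_mem_evenSeries {f g : ℤ⟦X⟧} (hf : f ∈ evenSeries) (h : f * g = 1) :
    g ∈ evenSeries := by
  have h0 : IsUnit (coeff 0 f) := by
    rw [coeff_zero_eq_constantCoeff_apply]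
    exact isUnit_iff_constantCoeff.mp (IsUnit.of_mul_eq_one _ h)
  intro k
  induction k using Nat.strong_induction_on with
  | _ k ih =>
    intro hk
    have h1 := congrArg (coeff k) h
    rw [coeff_mul, coeff_one, if_neg (by rintro rfl; simp at hk),
      Finset.sum_eq_single (0, k)] at h1
    · exact (h0.mul_right_eq_zero).mp h1
    · rintro ⟨i, j⟩ hx hne
      rw [Finset.HasAntidiagonal.mem_antidiagonal] at hx
      simp only at hx
      rcases Nat.even_or_odd i with hi | hi
      · have hj : Odd j := by subst hx; exact (Nat.odd_add'.mp hk).mpr hi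
        have : i ≠ 0 := by
          rintro rfl
          exact hne (by simpa using hx)
        rw [ih j (by omega) hj, mul_zero]
      · rw [hf i hi, zero_mul]
    · intro hx
      simp at hx

/-- Modulo `2`, the fourth power of a power series in `X ^ 2` is a power series in `X ^ 8`. -/
theorem coeff_map_pow_four {f : ℤ⟦X⟧} (hf : f ∈ evenSeries) {k : ℕ} (hk : ¬ 8 ∣ k) :
    coeff k (map (Int.castRingHom (ZMod 2)) f ^ 4) = 0 := by
  rw [show 4 = 2 * 2 by rfl, pow_mul, sq_eq_expand, sq_eq_expand, coeff_expand]
  split_ifs with h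
  · rw [coeff_expand]
    split_ifs with h2
    · rw [coeff_map, hf _ (by rw [Nat.odd_iff]; omega), map_zero]
    · rfl
  · rfl

end CoefficientsModTwo

/-! ### The congruence modulo 4 -/

section CongruenceModFour

open PowerSeries

theorem coeff_tsum_eq_sum {f : ℕ → ℤ⟦X⟧} (hf : Summable f) (h : ∀ n, X ^ n ∣ f n) {k N : ℕ}
    (hk : k ≤ N) : coeff k (∑' n, f n) = ∑ n ∈ Finset.range (N + 1), coeff k (f n) := by
  refine ((WithPiTopology.hasSum_iff_hasSum_coeff ℤ).mp hf.hasSum k).unique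
    (hasSum_sum_of_ne_finset_zero fun n hn => ?_)
  rw [Finset.mem_range] at hn
  exact X_pow_dvd_iff.mp (h n) k (by omega)

theorem invOfUnit_eq_of_mul_eq_one {a b : ℤ⟦X⟧} (ha : constantCoeff a = 1) (h : a * b = 1) :
    invOfUnit a 1 = b := by
  have h1 := mul_invOfUnit a 1 (by simpa using ha)
  linear_combination b * h1 - (invOfUnit a 1) * h

theorem invOfUnit_sq {a : ℤ⟦X⟧} (ha : constantCoeff a = 1) :
    invOfUnit (a ^ 2) 1 = invOfUnit a 1 ^ 2 := by
  refine invOfUnit_eq_of_mul_eq_one (by rw [map_pow, ha, one_pow]) ?_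
  rw [← mul_pow, mul_invOfUnit a 1 (by simpa using ha), one_pow]

/-- The product `(q ^ 2; q ^ 2)_n`. -/
noncomputable def evenPoch (n : ℕ) : ℤ⟦X⟧ := qPoch (X ^ 2) (X ^ 2) n

/-- The reciprocal of `(q ^ 2; q ^ 2)_n`. -/
noncomputable def evenPochInv (n : ℕ) : ℤ⟦X⟧ := invOfUnit (evenPoch n) 1

/-- The product `(q; q ^ 2)_n`. -/
noncomputable def oddPoch (n : ℕ) : ℤ⟦X⟧ := qPoch X (X ^ 2) n

/-- The product `(-q ^ 2; q ^ 2)_n`. -/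
noncomputable def negPoch (n : ℕ) : ℤ⟦X⟧ := qPoch (-X ^ 2) (X ^ 2) n

theorem constantCoeff_X_pow_succ (n : ℕ) : constantCoeff ((X : ℤ⟦X⟧) ^ (n + 1)) = 0 := by simp

theorem constantCoeff_oddPoch (n : ℕ) : constantCoeff (oddPoch n) = 1 :=
  constantCoeff_qPoch constantCoeff_X _ n

theorem evenPoch_mul_inv (n : ℕ) : evenPoch n * evenPochInv n = 1 :=
  mul_invOfUnit _ _ (constantCoeff_qPoch (constantCoeff_X_pow_succ 1) _ n)

theorem evenPochInv_zero : evenPochInv 0 = 1 := by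
  have := evenPoch_mul_inv 0
  simpa [evenPoch, qPoch] using this

theorem evenPoch_succ (n : ℕ) : evenPoch (n + 1) = evenPoch n * (1 - X ^ (2 * n + 2)) := by
  rw [evenPoch, qPoch_succ, evenPoch, ← pow_mul, ← pow_add, add_comm 2]

theorem evenPochInv_succ (n : ℕ) :
    evenPochInv n = (1 - X ^ (2 * n + 2)) * evenPochInv (n + 1) := by
  have h1 := evenPoch_mul_inv n
  have h2 := evenPoch_mul_inv (n + 1)
  rw [evenPoch_succ] at h2
  linear_combination (-evenPochInv n) * h2 + (1 - X ^ (2 * n + 2)) * evenPochInv (n + 1) * h1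

theorem oddPoch_succ (n : ℕ) : oddPoch (n + 1) = oddPoch n * (1 - X ^ (2 * n + 1)) := by
  rw [oddPoch, qPoch_succ, oddPoch, ← pow_mul, ← pow_succ']

theorem negPoch_succ (n : ℕ) : negPoch (n + 1) = negPoch n * (1 + X ^ (2 * n + 2)) := by
  rw [negPoch, qPoch_succ, negPoch, ← pow_mul]
  ring

/-- Factors of (q^2;q^2)_(j+M) beyond the M-th are 1 modulo X ^ K, so a tail is the whole product
divided by its first j factors. -/
theorem modXPow_tail_mul {K M : ℕ} (hK : K ≤ 2 * M + 2) (j : ℕ) :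
    modXPow K (qPoch (X ^ (2 * j + 2)) (X ^ 2) M) = modXPow K (evenPoch M * evenPochInv j) := by
  have h := qPoch_add (X ^ 2) ((X : ℤ⟦X⟧) ^ 2) j M
  rw [show (X : ℤ⟦X⟧) ^ 2 * (X ^ 2) ^ j = X ^ (2 * j + 2) by ring] at h
  have h2 : modXPow K (qPoch (X ^ 2) (X ^ 2) (j + M)) = modXPow K (evenPoch M) := by
    rw [add_comm]
    refine modXPow_qPoch_add ?_ j
    rw [← pow_mul, ← pow_add]
    exact pow_dvd_pow _ (by omega)
  rw [map_mul, ← h2, h, map_mul]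
  have h3 := congrArg (modXPow K) (evenPoch_mul_inv j)
  rw [map_mul, map_one, evenPoch] at h3
  linear_combination (-modXPow K (qPoch (X ^ (2 * j + 2)) (X ^ 2) M)) * h3

theorem modXPow_evenPoch_mul_inv {K M j : ℕ} (hK : K ≤ 2 * M + 2) (hj : K ≤ 2 * j + 2) :
    modXPow K (evenPoch M * evenPochInv j) = 1 := by
  rw [← modXPow_tail_mul hK, modXPow_qPoch_eq_one (pow_dvd_pow _ hj)]

/-- Modulo `X ^ K`, the reciprocal of `(q ^ (2 j + 1); q ^ 2)_∞`. -/
theorem modXPow_odd_tail_inv {K M : ℕ} (hK : K ≤ 2 * M + 1) (j : ℕ) :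
    modXPow K (invOfUnit (qPoch (X ^ (2 * j + 1)) (X ^ 2) M) 1) =
      modXPow K (oddPoch j * invOfUnit (oddPoch M) 1) := by
  have h := qPoch_add X ((X : ℤ⟦X⟧) ^ 2) j M
  rw [show (X : ℤ⟦X⟧) * (X ^ 2) ^ j = X ^ (2 * j + 1) by ring] at h
  have h2 : modXPow K (qPoch X (X ^ 2) (j + M)) = modXPow K (oddPoch M) := by
    rw [add_comm]
    refine modXPow_qPoch_add ?_ j
    rw [← pow_mul, ← pow_succ']
    exact pow_dvd_pow _ (by omega)
  rw [h, map_mul] at h2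
  have h3 := congrArg (modXPow K) (mul_invOfUnit (oddPoch M) 1
    (constantCoeff_oddPoch M))
  have h4 := congrArg (modXPow K) (mul_invOfUnit (qPoch (X ^ (2 * j + 1)) ((X : ℤ⟦X⟧) ^ 2) M) 1
    (by simpa using constantCoeff_qPoch (constantCoeff_X_pow_succ (2 * j)) _ M))
  rw [map_mul, map_one] at h3 h4
  rw [← h2] at h3
  rw [map_mul, oddPoch]
  linear_combination (-modXPow K (invOfUnit (qPoch (X ^ (2 * j + 1)) (X ^ 2) M) 1)) * h3 +
    (modXPow K (qPoch X (X ^ 2) j)) * modXPow K (invOfUnit (oddPoch M) 1) * h4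

theorem modXPow_seriesCTerm {K M : ℕ} (hK : K ≤ 2 * M) (j : ℕ) :
    modXPow K (seriesCTerm j) = modXPow K (X * (qPoch (-X ^ (2 * j + 2)) (X ^ 2) M *
      (X ^ (2 * j) * invOfUnit (qPoch (X ^ (2 * j + 1)) (X ^ 2) M) 1 ^ 2))) := by
  have h1 : modXPow K (qPochInf (-X ^ (2 * j + 2)) (X ^ 2)) =
      modXPow K (qPoch (-X ^ (2 * j + 2)) (X ^ 2) M) := by
    refine modXPow_qPochInf ?_
    rw [neg_mul, dvd_neg, ← pow_mul, ← pow_add]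
    exact pow_dvd_pow _ (by omega)
  have h2 : modXPow K (qPochInf (X ^ (2 * j + 1)) (X ^ 2)) =
      modXPow K (qPoch (X ^ (2 * j + 1)) (X ^ 2) M) := by
    refine modXPow_qPochInf ?_
    rw [← pow_mul, ← pow_add]
    exact pow_dvd_pow _ (by omega)
  have c1 := qPochInf_const _ (constantCoeff_X_pow_succ (2 * j))
  have c2 := constantCoeff_qPoch (constantCoeff_X_pow_succ (2 * j)) (X ^ 2) M
  rw [seriesCTerm, psDiv, invOfUnit_sq c1]
  simp only [map_mul, map_pow, h1, modXPow_invOfUnit c1 c2 h2]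
  ring

/-- Only even-index coefficients of a contribute; each is even, and it meets an odd-index
coefficient of a square, which is even too. -/
theorem four_dvd_coeff_mul_sq {a : ℤ⟦X⟧} (ha : a ∈ evenSeries) (ha2 : ∀ k, 2 ∣ coeff k a)
    (w : ℤ⟦X⟧) {k : ℕ} (hk : Odd k) : 4 ∣ coeff k (a * w ^ 2) := by
  rw [coeff_mul]
  refine Finset.dvd_sum fun x hx => ?_
  rw [Finset.HasAntidiagonal.mem_antidiagonal] at hx
  rcases Nat.even_or_odd x.1 with h | h
  · exact mul_dvd_mul (ha2 _) (two_dvd_coeff_sq (by subst hx; exact (Nat.odd_add'.mp hk).mpr h) w)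
  · rw [ha x.1 h, zero_mul]
    exact dvd_zero _

theorem X_pow_mem_evenSeries {k : ℕ} (hk : Even k) : (X : ℤ⟦X⟧) ^ k ∈ evenSeries := by
  obtain ⟨j, rfl⟩ := hk
  rw [← two_mul, pow_mul]
  exact pow_mem X_sq_mem_evenSeries j

theorem neg_eq_self_modTwo (f : (ZMod 2)⟦X⟧) : -f = f := by
  ext k
  rw [map_neg, ZMod.neg_eq_self_mod_two]

theorem map_qPoch_neg (a : ℤ⟦X⟧) (n : ℕ) :
    map (Int.castRingHom (ZMod 2)) (qPoch (-a) (X ^ 2) n) =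
      map (Int.castRingHom (ZMod 2)) (qPoch a (X ^ 2) n) := by
  rw [qPoch, qPoch, map_prod, map_prod]
  refine Finset.prod_congr rfl fun j _ => ?_
  rw [neg_mul, map_sub, map_sub, map_neg, neg_eq_self_modTwo]

theorem four_dvd_coeff_sub (j M : ℕ) (w : ℤ⟦X⟧) {k : ℕ} (hk : Odd k) :
    4 ∣ coeff k (qPoch (-X ^ (2 * j + 2)) (X ^ 2) M * (X ^ (2 * j) * w ^ 2)) -
      coeff k (qPoch (X ^ (2 * j + 2)) (X ^ 2) M * (X ^ (2 * j) * w ^ 2)) := by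
  have hX : (X : ℤ⟦X⟧) ^ (2 * j + 2) ∈ evenSeries := X_pow_mem_evenSeries ⟨j + 1, by ring⟩
  rw [← map_sub, ← sub_mul, mul_comm 2 j, pow_mul, ← mul_pow]
  refine four_dvd_coeff_mul_sq (sub_mem (qPoch_mem_evenSeries (neg_mem ?_) M)
    (qPoch_mem_evenSeries ?_ M)) (fun i => ?_) _ hk
  · convert hX using 2; ring
  · convert hX using 2; ring
  · rw [even_coeff_iff, map_sub, map_qPoch_neg, sub_self, map_zero]

/-- The partial sums of the expansion of `(1 + y) / (1 - y)` with `y = X ^ (2 * r + 1)`, up to its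
even part, summed against `(-1) ^ r * X ^ (3 * r * (r + 1))`. -/
noncomputable def appellOdd (N : ℕ) : ℤ⟦X⟧ :=
  ∑ r ∈ Finset.range (N + 1), (-1) ^ r * X ^ (3 * r * (r + 1)) *
    ∑ k ∈ Finset.range (N + 1), X ^ ((2 * r + 1) * (2 * k + 1))

theorem even_three_mul_mul_succ (r : ℕ) : Even (3 * r * (r + 1)) := by
  rw [mul_assoc]
  exact (Nat.even_mul_succ_self r).mul_left 3

theorem geom_split (y v : ℤ⟦X⟧) (hv : (1 - y) * v = 1) (N : ℕ) :
    (1 + y) * v = 1 + 2 * ∑ k ∈ Finset.range (N + 1), y ^ (2 * k + 2) +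
      2 * ∑ k ∈ Finset.range (N + 1), y ^ (2 * k + 1) + 2 * y ^ (2 * N + 3) * v := by
  induction N with
  | zero =>
    simp only [zero_add, Finset.sum_range_one, mul_zero, pow_one]
    linear_combination (1 + 2 * y + 2 * y ^ 2) * hv
  | succ N ih =>
    rw [ih, Finset.sum_range_succ _ (N + 1), Finset.sum_range_succ _ (N + 1)]
    linear_combination (2 * y ^ (2 * N + 3) * (1 + y)) * hv

/-- The main term, truncated: modulo `X ^ (2 * N + 2)` it is twice the odd part of an Appell-type
sum, divided by `(q ^ 2; q ^ 2)_∞`, plus a series in `X ^ 2`. -/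
theorem exists_modXPow_main (N : ℕ) : ∃ e ∈ evenSeries,
    modXPow (2 * N + 2) (∑ j ∈ Finset.range (N + 1), qPoch (X ^ (2 * j + 2)) (X ^ 2) (N + 1) *
      (X ^ (2 * j) * invOfUnit (qPoch (X ^ (2 * j + 1)) (X ^ 2) (N + 1)) 1 ^ 2)) =
    modXPow (2 * N + 2) (e + 2 * (evenPochInv (N + 1) * appellOdd N)) := by
  set v : ℕ → ℤ⟦X⟧ := fun r => invOfUnit (1 - X ^ (2 * r + 1)) 1
  have hv : ∀ r, (1 - X ^ (2 * r + 1)) * v r = 1 := fun r => mul_invOfUnit _ _ (by simp)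
  have hG := mul_invOfUnit (oddPoch (N + 1)) 1
    (constantCoeff_oddPoch (N + 1))
  set G := invOfUnit (oddPoch (N + 1)) 1
  have key := sum_bailey_eq X evenPochInv v oddPoch evenPochInv_zero evenPochInv_succ hv
    (by simp [oddPoch, qPoch]) oddPoch_succ N
  -- The factor with index N - r is known to be 1 only modulo X ^ (2(N - r) + 2); the missing 2r
  -- powers are supplied by X ^ (3r(r+1)).
  have h1 : ∀ r ∈ Finset.range (N + 1),
      modXPow (2 * N + 2) (X ^ (3 * r * (r + 1)) * (evenPoch (N + 1) * evenPochInv (N - r)) *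
        (evenPoch (N + 1) * evenPochInv (N + r + 1))) =
      modXPow (2 * N + 2) (X ^ (3 * r * (r + 1))) := by
    intro r hr
    rw [Finset.mem_range] at hr
    rw [map_mul, modXPow_evenPoch_mul_inv (by omega) (by omega), mul_one]
    have h2 : modXPow (2 * (N - r) + 2) (evenPoch (N + 1) * evenPochInv (N - r)) =
        modXPow (2 * (N - r) + 2) 1 := by
      rw [modXPow_evenPoch_mul_inv (by omega) le_rfl, map_one]
    rw [modXPow_eq_iff] at h2 ⊢
    rw [← mul_sub_one]
    refine (pow_dvd_pow _ ?_).trans ((pow_add (X : ℤ⟦X⟧) (3 * r * (r + 1)) _) ▸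
      mul_dvd_mul_left _ h2)
    have : r ≤ r * (r + 1) := Nat.le_mul_of_pos_right _ (by omega)
    rw [mul_assoc]
    omega
  set W := ∑ r ∈ Finset.range (N + 1), (-1) ^ r * X ^ (3 * r * (r + 1)) *
    ((1 + X ^ (2 * r + 1)) * v r)
  have hB : modXPow (2 * N + 2) (∑ j ∈ Finset.range (N + 1),
      qPoch (X ^ (2 * j + 2)) (X ^ 2) (N + 1) *
      (X ^ (2 * j) * invOfUnit (qPoch (X ^ (2 * j + 1)) (X ^ 2) (N + 1)) 1 ^ 2)) =
      modXPow (2 * N + 2) (evenPochInv (N + 1) * W) := by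
    have h3 : modXPow (2 * N + 2) (∑ j ∈ Finset.range (N + 1),
        qPoch (X ^ (2 * j + 2)) (X ^ 2) (N + 1) *
        (X ^ (2 * j) * invOfUnit (qPoch (X ^ (2 * j + 1)) (X ^ 2) (N + 1)) 1 ^ 2)) =
        modXPow (2 * N + 2) (evenPoch (N + 1) * G ^ 2 *
          ∑ n ∈ Finset.range (N + 1), X ^ (2 * n) * oddPoch n ^ 2 * evenPochInv n) := by
      rw [Finset.mul_sum, map_sum, map_sum]
      refine Finset.sum_congr rfl fun j _ => ?_
      have h4 := modXPow_tail_mul (K := 2 * N + 2) (M := N + 1) (by omega) j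
      have h5 := modXPow_odd_tail_inv (K := 2 * N + 2) (M := N + 1) (by omega) j
      simp only [map_mul, map_pow] at h4 h5 ⊢
      rw [h4, h5]
      ring
    rw [h3, key, ← mul_assoc, mul_assoc (evenPoch (N + 1)), ← mul_pow, mul_comm G, hG, one_pow,
      mul_one]
    have h6 : modXPow (2 * N + 2) (evenPoch (N + 1) * (evenPoch (N + 1) *
        ∑ r ∈ Finset.range (N + 1), (-1) ^ r * X ^ (3 * r * (r + 1)) *
          ((1 + X ^ (2 * r + 1)) * v r) * evenPochInv (N - r) * evenPochInv (N + r + 1))) =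
        modXPow (2 * N + 2) W := by
      rw [Finset.mul_sum, Finset.mul_sum, map_sum, map_sum]
      refine Finset.sum_congr rfl fun r hr => ?_
      have h7 := h1 r hr
      rw [show evenPoch (N + 1) * (evenPoch (N + 1) * ((-1) ^ r * X ^ (3 * r * (r + 1)) *
          ((1 + X ^ (2 * r + 1)) * v r) * evenPochInv (N - r) * evenPochInv (N + r + 1))) =
          (X ^ (3 * r * (r + 1)) * (evenPoch (N + 1) * evenPochInv (N - r)) *
          (evenPoch (N + 1) * evenPochInv (N + r + 1))) * ((-1) ^ r *
          ((1 + X ^ (2 * r + 1)) * v r)) by ring, map_mul, h7, ← map_mul]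
      congr 1
      ring
    rw [map_mul _ (evenPochInv (N + 1)), ← h6, ← map_mul,
      ← mul_assoc (evenPochInv _), mul_comm (evenPochInv _), evenPoch_mul_inv, one_mul]
  refine ⟨evenPochInv (N + 1) * ∑ r ∈ Finset.range (N + 1), (-1) ^ r * X ^ (3 * r * (r + 1)) *
    (1 + 2 * ∑ k ∈ Finset.range (N + 1), X ^ ((2 * r + 1) * (2 * k + 2))), ?_, ?_⟩
  · refine mul_mem (inverse_mem_evenSeries (qPoch_mem_evenSeries X_sq_mem_evenSeries (N + 1))
      (evenPoch_mul_inv _)) (sum_mem fun r _ => mul_mem (mul_mem (pow_mem (neg_mem (one_mem _)) r)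
      (X_pow_mem_evenSeries (even_three_mul_mul_succ r))) (add_mem (one_mem _) (mul_mem ?_
      (sum_mem fun k _ => X_pow_mem_evenSeries ?_))))
    · exact ofNat_mem evenSeries 2
    · exact Even.mul_left ⟨k + 1, by ring⟩ _
  · rw [hB, show ∀ a b c : ℤ⟦X⟧, a * b + 2 * (a * c) = a * (b + 2 * c) by intros; ring,
      map_mul, map_mul]
    congr 1
    rw [appellOdd, Finset.mul_sum, ← Finset.sum_add_distrib, map_sum, map_sum]
    refine Finset.sum_congr rfl fun r _ => ?_
    rw [geom_split _ _ (hv r) N, modXPow_eq_iff]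
    simp only [← pow_mul]
    rw [show ∀ a b c d e : ℤ⟦X⟧, a * b * (1 + 2 * c + 2 * d + 2 * X ^ ((2 * r + 1) * (2 * N + 3)) *
      e) - (a * b * (1 + 2 * c) + 2 * (a * b * d)) = X ^ ((2 * r + 1) * (2 * N + 3)) *
      (2 * a * b * e) by intros; ring]
    exact Dvd.dvd.mul_right (pow_dvd_pow _ (by nlinarith)) _

/-- Modulo `2`, the cube of `(q ^ 2; q ^ 2)_∞` is the generating function of triangular numbers. -/
theorem modXPow_sum_triangular (N : ℕ) :
    modXPow (2 * N + 2) (∑ r ∈ Finset.range (N + 1), X ^ (r * (r + 1))) =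
      modXPow (2 * N + 2) (evenPoch (N + 1) * negPoch (N + 1) ^ 2) := by
  have key := sum_triangular_eq X evenPochInv negPoch evenPochInv_zero evenPochInv_succ
    (by simp [negPoch, qPoch]) negPoch_succ N
  have hneg : modXPow (2 * N + 2) (negPoch (N + 1)) = modXPow (2 * N + 2) (negPoch N) := by
    refine modXPow_qPoch_add ?_ 1
    rw [neg_mul, dvd_neg, ← pow_mul, ← pow_add]
    exact pow_dvd_pow _ (by omega)
  have h1 : modXPow (2 * N + 2) (evenPoch (N + 1) ^ 2 * ∑ r ∈ Finset.range (N + 1),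
      X ^ (r * (r + 1)) * evenPochInv (N - r) * evenPochInv (N + r + 1)) =
      modXPow (2 * N + 2) (∑ r ∈ Finset.range (N + 1), X ^ (r * (r + 1))) := by
    rw [Finset.mul_sum, map_sum, map_sum]
    refine Finset.sum_congr rfl fun r hr => ?_
    rw [Finset.mem_range] at hr
    rw [show evenPoch (N + 1) ^ 2 * (X ^ (r * (r + 1)) * evenPochInv (N - r) *
      evenPochInv (N + r + 1)) = X ^ (r * (r + 1)) * (evenPoch (N + 1) * evenPochInv (N - r)) *
      (evenPoch (N + 1) * evenPochInv (N + r + 1)) by ring, map_mul,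
      modXPow_evenPoch_mul_inv (by omega) (by omega), mul_one]
    -- Here X ^ (r(r+1)) supplies the 2r missing powers.
    have h2 : modXPow (2 * (N - r) + 2) (evenPoch (N + 1) * evenPochInv (N - r)) =
        modXPow (2 * (N - r) + 2) 1 := by
      rw [modXPow_evenPoch_mul_inv (by omega) le_rfl, map_one]
    rw [modXPow_eq_iff] at h2 ⊢
    rw [← mul_sub_one]
    refine (pow_dvd_pow _ ?_).trans ((pow_add (X : ℤ⟦X⟧) (r * (r + 1)) _) ▸
      mul_dvd_mul_left _ h2)
    rcases r with _ | r
    · omega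
    · have : 2 * (r + 1) ≤ (r + 1) * (r + 1 + 1) := by nlinarith
      omega
  rw [← h1, key, show evenPoch (N + 1) ^ 2 * (negPoch N ^ 2 * evenPochInv (2 * N + 1)) =
    evenPoch (N + 1) * negPoch N ^ 2 * (evenPoch (N + 1) * evenPochInv (2 * N + 1)) by ring,
    map_mul, modXPow_evenPoch_mul_inv (by omega) (by omega), mul_one, map_mul, map_mul, map_pow,
    map_pow, hneg]

theorem coeff_triangular_mul_appellOdd {n N : ℕ} (hN : 8 * n + 3 ≤ N) :
    coeff (8 * n + 3) (map (Int.castRingHom (ZMod 2))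
      ((∑ m ∈ Finset.range (N + 1), X ^ (m * (m + 1))) * appellOdd N)) = 0 := by
  have h : map (Int.castRingHom (ZMod 2))
      ((∑ m ∈ Finset.range (N + 1), X ^ (m * (m + 1))) * appellOdd N) =
      ∑ x ∈ Finset.range (N + 1) ×ˢ Finset.range (N + 1) ×ˢ Finset.range (N + 1),
        X ^ (x.1 * (x.1 + 1) + 3 * x.2.1 * (x.2.1 + 1) + (2 * x.2.1 + 1) * (2 * x.2.2 + 1)) := by
    have h2 : (-1 : (ZMod 2)⟦X⟧) = 1 := neg_eq_self_modTwo 1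
    simp only [appellOdd, map_mul, map_sum, map_pow, map_X, map_neg, map_one, h2, one_pow, one_mul]
    rw [Finset.sum_mul, Finset.sum_product]
    refine Finset.sum_congr rfl fun m _ => ?_
    rw [Finset.mul_sum, Finset.sum_product]
    refine Finset.sum_congr rfl fun r _ => ?_
    rw [Finset.mul_sum, Finset.mul_sum]
    refine Finset.sum_congr rfl fun k _ => ?_
    simp only [pow_add, mul_assoc]
  rw [h, map_sum]
  simp only [coeff_X_pow]
  have := even_card_windmill n N hN
  rw [← ZMod.natCast_eq_zero_iff_even, Finset.card_filter, Nat.cast_sum] at this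
  simpa [eq_comm] using this

theorem two_dvd_coeff_main (n N : ℕ) (hN : 8 * n + 3 ≤ N) :
    2 ∣ coeff (8 * n + 3) (evenPochInv (N + 1) * appellOdd N) := by
  set φ := PowerSeries.map (Int.castRingHom (ZMod 2))
  have hu := evenPoch_mul_inv (N + 1)
  have heven : evenPochInv (N + 1) ∈ evenSeries := inverse_mem_evenSeries
    (qPoch_mem_evenSeries X_sq_mem_evenSeries (N + 1)) hu
  have hneg : φ (negPoch (N + 1)) = φ (evenPoch (N + 1)) := map_qPoch_neg (X ^ 2) (N + 1)
  -- This is 1/E = E^3/E^4, with E^3 written as E · (-q^2;q^2)^2 so that Gauss's identity applies.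
  have h1 : φ (evenPochInv (N + 1) * appellOdd N) = φ (evenPochInv (N + 1) ^ 4 *
      (evenPoch (N + 1) * negPoch (N + 1) ^ 2) * appellOdd N) := by
    have h2 := congrArg φ hu
    rw [map_mul, map_one] at h2
    simp only [map_mul, map_pow, hneg]
    rw [show φ (evenPochInv (N + 1)) ^ 4 * (φ (evenPoch (N + 1)) * φ (evenPoch (N + 1)) ^ 2) =
      φ (evenPochInv (N + 1)) * (φ (evenPoch (N + 1)) * φ (evenPochInv (N + 1))) ^ 3 by ring, h2,
      one_pow, mul_one]
  have h3 : coeff (8 * n + 3) (evenPochInv (N + 1) ^ 4 *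
      (evenPoch (N + 1) * negPoch (N + 1) ^ 2) * appellOdd N) =
      coeff (8 * n + 3) (evenPochInv (N + 1) ^ 4 *
      (∑ m ∈ Finset.range (N + 1), X ^ (m * (m + 1))) * appellOdd N) := by
    refine coeff_eq_of_modXPow_eq (K := 2 * N + 2) (by omega) ?_
    rw [map_mul, map_mul, ← modXPow_sum_triangular, ← map_mul, ← map_mul]
  rw [even_coeff_iff, h1, coeff_map, h3, ← coeff_map, mul_assoc, map_mul, map_pow, coeff_mul]
  refine Finset.sum_eq_zero fun x hx => ?_
  rw [Finset.HasAntidiagonal.mem_antidiagonal] at hx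
  -- The fourth power contributes only exponents divisible by 8, so the cofactor is read at an
  -- exponent still of the form 8i + 3.
  by_cases h8 : 8 ∣ x.1
  · obtain ⟨i, hi⟩ := h8
    rw [show x.2 = 8 * (n - i) + 3 by omega, coeff_triangular_mul_appellOdd (by omega), mul_zero]
  · rw [coeff_map_pow_four heven h8, zero_mul]

theorem X_pow_dvd_seriesCTerm (n : ℕ) : X ^ n ∣ seriesCTerm n :=
  (pow_dvd_pow X (by omega : n ≤ 2 * n + 1)).trans
    (Dvd.dvd.mul_right (Dvd.intro_left _ rfl) _)

theorem four_dvd_coeffC (n : ℕ) : 4 ∣ coeffC (8 * n + 4) := by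
  set N := 8 * n + 4 with hN
  obtain ⟨e, he, h⟩ := exists_modXPow_main N
  have h1 := coeff_eq_of_modXPow_eq (k := 8 * n + 3) (by omega) h
  have hodd : Odd (8 * n + 3) := ⟨4 * n + 1, by ring⟩
  rw [map_sum, map_add, he _ hodd, zero_add] at h1
  have h2 : 4 ∣ coeff (8 * n + 3) (2 * (evenPochInv (N + 1) * appellOdd N)) := by
    rw [two_mul, map_add, ← two_mul]
    exact mul_dvd_mul_left 2 (two_dvd_coeff_main n N (by omega))
  rw [coeffC, seriesC, coeff_tsum_eq_sum summable_C X_pow_dvd_seriesCTerm hN.symm.le]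
  have h3 : ∀ j, coeff (8 * n + 4) (seriesCTerm j) = coeff (8 * n + 3)
      (qPoch (-X ^ (2 * j + 2)) (X ^ 2) (N + 1) *
      (X ^ (2 * j) * invOfUnit (qPoch (X ^ (2 * j + 1)) (X ^ 2) (N + 1)) 1 ^ 2)) := by
    intro j
    rw [coeff_eq_of_modXPow_eq (K := 2 * N + 2) (by omega) (modXPow_seriesCTerm (M := N + 1) (by omega) j),
      show 8 * n + 4 = 8 * n + 3 + 1 by rfl, coeff_succ_X_mul]
  rw [Finset.sum_congr rfl fun j _ => h3 j, ← dvd_sub_left h2, ← h1, ← Finset.sum_sub_distrib]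
  exact Finset.dvd_sum fun j _ => four_dvd_coeff_sub j _ _ hodd

end CongruenceModFour

/-! ### The factorisation C = qAS -/

section Factorisation

open PowerSeries

theorem seriesCTerm_eq (n : ℕ) : seriesCTerm n = X * seriesA * seriesSTerm n := by
  have hg := qPochInf_eq_qPoch_mul X n
  have hd := qPochInf_eq_qPoch_mul (-X ^ 2) n
  rw [show (X : ℤ⟦X⟧) * (X ^ 2) ^ n = X ^ (2 * n + 1) by ring] at hg
  rw [show -(X : ℤ⟦X⟧) ^ 2 * (X ^ 2) ^ n = -X ^ (2 * n + 2) by ring] at hd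
  have h1 := mul_invOfUnit (qPochInf (X ^ (2 * n + 1)) (X ^ 2) ^ 2) 1
    (by simp [qPochInf_const _ (constantCoeff_X_pow_succ (2 * n))])
  have h2 := mul_invOfUnit (qPochInf X (X ^ 2) ^ 2) 1 (by simp [qPochInf_const])
  have h3 := mul_invOfUnit (qPoch (-X ^ 2) (X ^ 2) n) 1 (by simp [constantCoeff_qPoch])
  rw [seriesCTerm, seriesA, seriesSTerm, psDiv, psDiv, psDiv, hd]
  set a := invOfUnit (qPochInf (X ^ (2 * n + 1)) (X ^ 2) ^ 2) 1
  set b := invOfUnit (qPochInf X (X ^ 2) ^ 2) 1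
  rw [hg] at h2
  have h4 : b * qPoch X (X ^ 2) n ^ 2 = a := by
    linear_combination a * h2 - b * qPoch X (X ^ 2) n ^ 2 * h1
  rw [← h4]
  linear_combination (-qPochInf (-X ^ (2 * n + 2)) (X ^ 2) * X ^ (2 * n + 1) * b *
    qPoch X (X ^ 2) n ^ 2) * h3

theorem seriesC_eq : seriesC = X * seriesA * seriesS := by
  rw [seriesC, seriesS, ← summable_S.tsum_mul_left]
  exact tsum_congr seriesCTerm_eq

end Factorisation

/-! ### Generating functions of the blue and the red parts -/

section GeneratingFunctions

open PowerSeries PowerSeries.WithPiTopology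

theorem hasProd_qPochInf_shift (a : ℤ⟦X⟧) (s : ℕ) (F : ℕ → ℤ⟦X⟧) (h1 : ∀ j < s, F j = 1)
    (h2 : ∀ j, F (j + s) = 1 - a * (X ^ 2) ^ j) : HasProd F (qPochInf a (X ^ 2)) := by
  have h := (multipliable_qPoch a).hasProd
  rw [← funext h2] at h
  have := h.prod_range_mul
  rwa [Finset.prod_eq_one fun j hj => h1 j (Finset.mem_range.mp hj), one_mul,
    funext h2] at this

theorem hasProd_odd_factors (s : ℕ) :
    HasProd (fun i : ℕ => if Odd (i + 1) ∧ 2 * s + 1 ≤ i + 1 then 1 - (X : ℤ⟦X⟧) ^ (i + 1) else 1)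
      (qPochInf (X ^ (2 * s + 1)) (X ^ 2)) := by
  rw [← mul_one (qPochInf _ _)]
  -- Index i stands for the part i + 1, so odd parts sit at even indices.
  refine HasProd.even_mul_odd (hasProd_qPochInf_shift _ s _ (fun j hj => ?_) fun j => ?_) ?_
  · rw [if_neg (by omega)]
  · rw [if_pos ⟨⟨j + s, rfl⟩, by omega⟩, ← pow_mul, ← pow_add]
    congr 2
    ring
  · convert! hasProd_one using 2 with j
    rw [if_neg]
    rintro ⟨⟨c, hc⟩, -⟩
    omega

theorem hasProd_even_factors (s : ℕ) :
    HasProd (fun i : ℕ => if Even (i + 1) ∧ 2 * s + 1 ≤ i + 1 then 1 + (X : ℤ⟦X⟧) ^ (i + 1) else 1)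
      (qPochInf (-X ^ (2 * s + 2)) (X ^ 2)) := by
  rw [← one_mul (qPochInf _ _)]
  refine HasProd.even_mul_odd ?_ (hasProd_qPochInf_shift _ s _ (fun j hj => ?_) fun j => ?_)
  · convert! hasProd_one using 2 with j
    rw [if_neg]
    rintro ⟨⟨c, hc⟩, -⟩
    omega
  · rw [if_neg (by omega)]
  · rw [if_pos ⟨⟨j + s + 1, by ring⟩, by omega⟩, neg_mul, sub_neg_eq_add, ← pow_mul, ← pow_add]
    congr 2
    ring

/-- The generating function of partitions into odd parts that are at least `2 * s + 1`. -/
noncomputable def blueGenFun (s : ℕ) : ℤ⟦X⟧ :=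
  PowerSeries.mk fun n => ((Nat.Partition.restricted n fun i => Odd i ∧ 2 * s + 1 ≤ i).card : ℤ)

/-- The generating function of partitions into parts that are at least `2 * s + 1`, with distinct
even parts. -/
noncomputable def redGenFun (s : ℕ) : ℤ⟦X⟧ :=
  Nat.Partition.genFun fun i c => if 2 * s + 1 ≤ i ∧ (Even i → c ≤ 1) then 1 else 0

theorem blueGenFun_mul (s : ℕ) : blueGenFun s * qPochInf (X ^ (2 * s + 1)) (X ^ 2) = 1 := by
  refine ((Nat.Partition.hasProd_powerSeriesMk_card_restricted ℤ
    fun i => Odd i ∧ 2 * s + 1 ≤ i).mul (hasProd_odd_factors s)).unique ?_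
  convert! hasProd_one using 2 with i
  split_ifs
  · simp_rw [pow_mul]
    exact tsum_pow_mul_one_sub_of_constantCoeff_eq_zero (by simp)
  · rw [one_mul]

theorem redGenFun_mul (s : ℕ) : redGenFun s * qPochInf (X ^ (2 * s + 1)) (X ^ 2) =
    qPochInf (-X ^ (2 * s + 2)) (X ^ 2) := by
  have h0 := Nat.Partition.hasProd_genFun
    fun i c => if 2 * s + 1 ≤ i ∧ (Even i → c ≤ 1) then (1 : ℤ) else 0
  simp_rw [smul_eq_C_mul] at h0
  refine (h0.mul (hasProd_odd_factors s)).unique ?_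
  convert! hasProd_even_factors s using 2 with i
  by_cases hs : 2 * s + 1 ≤ i + 1
  · rcases Nat.even_or_odd (i + 1) with h | h
    -- Index j stands for multiplicity j + 1, so a distinct even part leaves only j = 0.
    · rw [if_neg (fun h2 => Nat.not_odd_iff_even.mpr h h2.1), mul_one, if_pos ⟨h, hs⟩,
        tsum_eq_single 0]
      · simp [hs]
      · intro j hj
        rw [if_neg (fun h2 => by have := h2.2 h; omega), map_zero, zero_mul]
    · rw [if_pos ⟨h, hs⟩, if_neg (fun h2 => Nat.not_odd_iff_even.mpr h2.1 h)]
      have h3 : ∀ j : ℕ, (2 * s + 1 ≤ i + 1 ∧ (Even (i + 1) → j + 1 ≤ 1)) := fun j =>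
        ⟨hs, fun h2 => absurd h (Nat.not_odd_iff_even.mpr h2)⟩
      have h4 : constantCoeff ((X : ℤ⟦X⟧) ^ (i + 1)) = 0 := constantCoeff_X_pow_succ i
      have hgeom := tsum_pow_mul_one_sub_of_constantCoeff_eq_zero h4
      have hsum : Summable fun j : ℕ => ((X : ℤ⟦X⟧) ^ (i + 1)) ^ (j + 1) := by
        have := (summable_pow_of_constantCoeff_eq_zero h4).mul_right ((X : ℤ⟦X⟧) ^ (i + 1))
        exact this.congr fun j => pow_succ _ j
      rw [tsum_eq_zero_add' hsum, pow_zero] at hgeom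
      simp only [if_pos (h3 _), map_one, one_mul, pow_mul]
      exact hgeom
  · simp [hs]

/-- The difference of blue series counts the partitions in which 2s+1 really occurs; algebraically
it is X ^ (2s+1) times the first series. -/
theorem seriesCTerm_eq_genFun (s : ℕ) :
    seriesCTerm s = (blueGenFun s - blueGenFun (s + 1)) * redGenFun s := by
  have hsplit := qPochInf_eq_qPoch_mul (X ^ (2 * s + 1)) 1
  rw [show (X : ℤ⟦X⟧) ^ (2 * s + 1) * (X ^ 2) ^ 1 = X ^ (2 * (s + 1) + 1) by ring, qPoch,
    Finset.prod_range_one, pow_zero, mul_one] at hsplit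
  have h1 := blueGenFun_mul s
  have h2 := blueGenFun_mul (s + 1)
  have h3 := redGenFun_mul s
  have h4 := mul_invOfUnit (qPochInf (X ^ (2 * s + 1)) (X ^ 2) ^ 2) 1
    (by simp [qPochInf_const _ (constantCoeff_X_pow_succ (2 * s))])
  rw [seriesCTerm, psDiv, ← h3]
  have h5 : blueGenFun s - blueGenFun (s + 1) = X ^ (2 * s + 1) * blueGenFun s := by
    rw [hsplit] at h1
    linear_combination blueGenFun (s + 1) * h1 - blueGenFun s * (1 - X ^ (2 * s + 1)) * h2
  rw [h5]
  set a := invOfUnit (qPochInf (X ^ (2 * s + 1)) (X ^ 2) ^ 2) 1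
  linear_combination (X ^ (2 * s + 1) * blueGenFun s * redGenFun s) * h4 -
    redGenFun s * qPochInf (X ^ (2 * s + 1)) (X ^ 2) * X ^ (2 * s + 1) * a * h1

end GeneratingFunctions

/-! ### Counting restricted partitions by their smallest part -/

section Counting

open PowerSeries

/-- The blue parts are odd, and the smallest one is `2 * s + 1`. -/
def IsBlue (s : ℕ) (p : Multiset ℕ) : Prop :=
  (∀ x ∈ p, Odd x ∧ 2 * s + 1 ≤ x) ∧ 2 * s + 1 ∈ p

/-- The red parts are at least `2 * s + 1`, and the even ones are distinct. -/
def IsRed (s : ℕ) (p : Multiset ℕ) : Prop :=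
  ∀ x ∈ p, 2 * s + 1 ≤ x ∧ (Even x → p.count x ≤ 1)

theorem IsBlue.eq_of_isBlue {s t : ℕ} {p : Multiset ℕ} (h : IsBlue s p) (h' : IsBlue t p) :
    s = t := by
  have h1 := (h.1 _ h'.2).2
  have h2 := (h'.1 _ h.2).2
  omega

/-- For k > n an even blue part would have to be larger than n, so all blue parts are odd and the
dependence on k disappears. -/
theorem isRestricted_iff {n k : ℕ} (hk : n < k) (p : TwoColorPartition n) :
    p.IsRestricted k ↔ ∃ s ∈ Finset.range (n + 1), IsBlue s p.blue ∧ IsRed s p.red := by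
  have hn : p.1.1.1 + p.1.1.2 = n := Finset.HasAntidiagonal.mem_antidiagonal.mp p.1.2
  have hle : ∀ x ∈ p.blue, x ≤ n := fun x hx =>
    (Nat.Partition.le_of_mem_parts hx).trans (by omega)
  constructor
  · rintro ⟨⟨m, hm, ⟨s, rfl⟩, hmin, heven⟩, hcount⟩
    have hs := hle _ hm
    refine ⟨s, Finset.mem_range.mpr (by omega), ⟨fun x hx => ⟨?_, ?_⟩, hm⟩, fun x hx => ⟨?_, ?_⟩⟩
    · by_contra hodd
      have h1 := heven x hx (Nat.not_odd_iff_even.mp hodd)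
      have h2 := hle x hx
      omega
    · exact hmin x (Multiset.mem_add.mpr (Or.inl hx))
    · exact hmin x (Multiset.mem_add.mpr (Or.inr hx))
    · exact fun h => (hcount x h).2
  · rintro ⟨s, -, ⟨hblue, hmem⟩, hred⟩
    refine ⟨⟨2 * s + 1, hmem, ⟨s, rfl⟩, fun x hx => ?_, fun x hx hx2 => ?_⟩, fun x hx => ⟨?_, ?_⟩⟩
    · rcases Multiset.mem_add.mp hx with h | h
      · exact (hblue x h).2
      · exact (hred x h).1
    · exact absurd (hblue x hx).1 (Nat.not_odd_iff_even.mpr hx2)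
    · rw [Multiset.count_eq_zero_of_notMem]
      · exact zero_le_one
      · exact fun h => Nat.not_odd_iff_even.mpr hx (hblue x h).1
    · by_cases h : x ∈ p.red
      · exact (hred x h).2 hx
      · rw [Multiset.count_eq_zero_of_notMem h]
        exact zero_le_one

open Classical in
theorem coeff_blueGenFun_sub (s n : ℕ) : coeff n (blueGenFun s - blueGenFun (s + 1)) =
    ∑ p : n.Partition, if IsBlue s p.parts then (1 : ℤ) else 0 := by
  rw [map_sub, blueGenFun, blueGenFun, coeff_mk, coeff_mk, Nat.Partition.restricted,
    Nat.Partition.restricted, Finset.card_filter, Finset.card_filter, Nat.cast_sum, Nat.cast_sum,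
    ← Finset.sum_sub_distrib]
  refine Finset.sum_congr rfl fun p _ => ?_
  by_cases h1 : ∀ x ∈ p.parts, Odd x ∧ 2 * s + 1 ≤ x
  · rw [if_pos h1]
    by_cases h2 : 2 * s + 1 ∈ p.parts
    · rw [if_neg, if_pos ⟨h1, h2⟩]
      · simp
      · intro h
        have := (h _ h2).2
        omega
    · rw [if_pos, if_neg fun h => h2 h.2]
      · simp
      · intro x hx
        obtain ⟨⟨c, rfl⟩, h4⟩ := h1 x hx
        refine ⟨⟨c, rfl⟩, ?_⟩
        have : c ≠ s := by
          rintro rfl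
          exact h2 hx
        omega
  · rw [if_neg h1, if_neg, if_neg fun h => h1 h.1]
    · simp
    · exact fun h => h1 fun x hx => ⟨(h x hx).1, by have := (h x hx).2; omega⟩

open Classical in
theorem coeff_redGenFun (s n : ℕ) : coeff n (redGenFun s) =
    ∑ p : n.Partition, if IsRed s p.parts then (1 : ℤ) else 0 := by
  rw [redGenFun, Nat.Partition.coeff_genFun]
  refine Finset.sum_congr rfl fun p _ => ?_
  rw [Finsupp.prod, Finset.prod_boole]
  simp [IsRed]

theorem restrictedCount_eq_coeff {n k : ℕ} (hk : n < k) :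
    (restrictedCount k n : ℤ) = coeff n seriesC := by
  classical
  rw [seriesC, coeff_tsum_eq_sum summable_C X_pow_dvd_seriesCTerm le_rfl]
  simp only [seriesCTerm_eq_genFun, coeff_mul, coeff_blueGenFun_sub, coeff_redGenFun,
    Finset.sum_mul_sum]
  -- The smallest blue part determines s, so the inner sum of indicators is 0 or 1.
  have h : (restrictedCount k n : ℤ) = ∑ p : TwoColorPartition n,
      ∑ s ∈ Finset.range (n + 1), if IsBlue s p.blue ∧ IsRed s p.red then (1 : ℤ) else 0 := by
    rw [restrictedCount, Nat.card_eq_fintype_card, Fintype.card_subtype, Finset.card_filter,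
      Nat.cast_sum]
    refine Finset.sum_congr rfl fun p _ => ?_
    by_cases hp : p.IsRestricted k
    · obtain ⟨s, hs, hQ⟩ := (isRestricted_iff hk p).mp hp
      rw [if_pos hp, Finset.sum_eq_single s, if_pos hQ, Nat.cast_one]
      · exact fun t _ hts => if_neg fun h => hts (h.1.eq_of_isBlue hQ.1)
      · exact fun h => absurd hs h
    · rw [if_neg hp, Finset.sum_eq_zero, Nat.cast_zero]
      exact fun s hs => if_neg fun h => hp ((isRestricted_iff hk p).mpr ⟨s, hs, h⟩)
  rw [h, Finset.sum_comm]
  refine Finset.sum_congr rfl fun s _ => ?_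
  rw [Fintype.sum_sigma, ← Finset.sum_coe_sort (Finset.HasAntidiagonal.antidiagonal n)]
  refine Finset.sum_congr rfl fun ij _ => ?_
  rw [Fintype.sum_prod_type]
  refine Finset.sum_congr rfl fun p _ => Finset.sum_congr rfl fun r _ => ?_
  rw [ite_zero_mul_ite_zero, one_mul]
  rfl

theorem tendsto_restrictedGenFun : Tendsto restrictedGenFun atTop (𝓝 seriesC) := by
  rw [WithPiTopology.tendsto_iff_coeff_tendsto]
  intro n
  refine tendsto_nhds_of_eventually_eq ?_
  filter_upwards [eventually_gt_atTop n] with k hk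
  rw [restrictedGenFun, coeff_mk, restrictedCount_eq_coeff hk]

end Counting

theorem theorem1p4 :
    Tendsto restrictedGenFun atTop (𝓝 seriesC) ∧
    seriesC = PowerSeries.X * seriesA * seriesS ∧
    ∀ n : ℕ, coeffC (8 * n + 4) ≡ 0 [ZMOD 4] :=
  ⟨tendsto_restrictedGenFun, seriesC_eq, fun n =>
    Int.modEq_zero_iff_dvd.mpr (four_dvd_coeffC n)⟩
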